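/- Let $G$ be a group with a presentation $\mathcal{P}=\langle X\mid w:R\to F(X)\rangle$: the set $R$ labels the relators $w(r)\in F(X)$ in the free group on $X$, and there is a surjective morphism $\theta:F(X)\to G$ whose kernel is the normal closure of $w(R)$. All actions are on the right. Let $\delta_2:C(R)\to F(X)$ be the free crossed $F(X)$-module on $w$. That is, $C(R)$ is the quotient of the free group on $R\times F(X)$, with $(r,u)^x=(r,ux)$ and $\delta_2(r,u)=u^{-1}w(r)u$, by the Peiffer relations $a^{-1}ba=b^{\delta_2 a}$; write $r\in C(R)$ for the class of $(r,1)$. The kernel $\pi_2(\mathcal{P})=\ker\delta_2$ is abelian, and the action of $F(X)$ makes it a right $\mathbb{Z}G$-module via $\theta$: the module of identities among relations. Let $F(\widetilde X)$ be the free groupoid on the Cayley graph: its objects are the elements of $G$, its arrows are $[g,u]:g\to g\,\theta(u)$ for $g\in G$, $u\in F(X)$, and $[g,u][g\,\theta(u),v]=[g,uv]$. Let $C(\widetilde R)$ be the disjoint union of the groups $C(\widetilde R)(g)=\{[g,c]: c\in C(R)\}$, $g\in G$, each isomorphic to $C(R)$ by $p_2[g,c]=c$, with $\tilde\delta_2[g,c]=[g,\delta_2c]$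 and $[g,c]^{[g,u]}=[g\,\theta(u),c^u]$. Let $h_0:G\to F(\widetilde X)$ and $h_1:F(\widetilde X)\to C(\widetilde R)(1)$ be a partial contracting homotopy, that is: (i) $h_0(g)$ is an arrow $g\to 1$ for every $g\in G$, and $h_0(1)$ is the identity arrow at $1$; (ii) $h_1$ is a morphism from the groupoid $F(\widetilde X)$ to the group $C(\widetilde R)(1)$; (iii) $\tilde\delta_2h_1[g,u]=h_0(g)^{-1}\,[g,u]\,h_0(g\,\theta(u))$ for all $g\in G$ and $u\in F(X)$. Define $\sigma:G\to F(X)$ by $h_0(g)=[g,\sigma(g)^{-1}]$. Then, for all $g\in G$ and $r\in R$, the element $$\mathrm{sep}(g,r)=p_2\bigl(h_1\tilde\delta_2[g,r]\bigr)^{-1}\,r^{\sigma(g)^{-1}}$$ of $C(R)$ lies in $\pi_2(\mathcal{P})$, and these elements generate $\pi_2(\mathcal{P})$ as a $\mathbb{Z}G$-module. -/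

import Mathlib

open CategoryTheory
open scoped RightActions

/-- A presentation `⟨X | w : R → F(X)⟩` of the group `G`: the generators `gen x` generate `G`, and
the kernel of the induced map `F(X) → G` is the normal closure of the relators. The relators are
indexed by a type `R` of labels, so that repeated relators are allowed. -/
structure GroupPresentation (G X R : Type*) [Group G] where
  /-- the generators, as elements of `G` -/
  gen : X → G
  /-- the relator `w r` with label `r` -/
  rel : R → FreeGroup X
  closure_gen : Subgroup.closure (Set.range gen) = ⊤
  ker_lift_gen : (FreeGroup.lift gen).ker = Subgroup.normalClosure (Set.range rel)

namespace GroupPresentation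

variable {G X R : Type*} [Group G] (P : GroupPresentation G X R)

/-- The canonical morphism `θ : F(X) → G`. -/
def θ : FreeGroup X →* G := FreeGroup.lift P.gen

theorem θ_surjective : Function.Surjective P.θ := by
  rw [← MonoidHom.range_eq_top, θ, FreeGroup.range_lift_eq_closure, P.closure_gen]

/-! ### The free crossed module of the presentation

All actions are right actions: `c <• u` is the element usually written `c ^ u`. -/

/-- The boundary of the free precrossed module: `(r, u) ↦ u⁻¹ (w r) u`, on the free group on the
set `Y = R × F(X)`. -/
def preδ₂ : FreeGroup (R × FreeGroup X) →* FreeGroup X :=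
  FreeGroup.lift fun y => y.2⁻¹ * P.rel y.1 * y.2

/-- The action `(r, u) ^ x = (r, u x)` of `x ∈ F(X)` on the free group on `Y = R × F(X)`. -/
def preAct (x : FreeGroup X) : FreeGroup (R × FreeGroup X) →* FreeGroup (R × FreeGroup X) :=
  FreeGroup.map fun y => (y.1, y.2 * x)

/-- The Peiffer elements `a⁻¹ b a (b ^ (δ a))⁻¹`. -/
def peiffer : Set (FreeGroup (R × FreeGroup X)) :=
  {p | ∃ a b, p = a⁻¹ * b * a * (preAct (P.preδ₂ a) b)⁻¹}

/-- The group `C(R)` of the free crossed `F(X)`-module on `w : R → F(X)`: the free group on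
`R × F(X)` modulo Peiffer equivalence. -/
def C : Type _ := FreeGroup (R × FreeGroup X) ⧸ Subgroup.normalClosure P.peiffer

instance : Group P.C :=
  inferInstanceAs (Group (FreeGroup (R × FreeGroup X) ⧸ Subgroup.normalClosure P.peiffer))

/-- The quotient map onto `C(R)`. -/
def mkC : FreeGroup (R × FreeGroup X) →* P.C :=
  QuotientGroup.mk' (Subgroup.normalClosure P.peiffer)

theorem mkC_surjective : Function.Surjective P.mkC := QuotientGroup.mk'_surjective _

/-- The free generator of `C(R)` with label `r`, usually written just `r`. -/
def ι (r : R) : P.C := P.mkC (FreeGroup.of (r, 1))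

theorem preδ₂_preAct (x : FreeGroup X) (a : FreeGroup (R × FreeGroup X)) :
    P.preδ₂ (preAct x a) = x⁻¹ * P.preδ₂ a * x := by
  have h : P.preδ₂.comp (preAct x) = (MulAut.conj x⁻¹).toMonoidHom.comp P.preδ₂ := by
    ext y
    simp [preδ₂, preAct, mul_assoc]
  simpa [MulAut.conj_apply] using DFunLike.congr_fun h a

theorem preAct_mul (x y : FreeGroup X) (a : FreeGroup (R × FreeGroup X)) :
    preAct (x * y) a = preAct y (preAct x a) := by
  have h : preAct (R := R) (x * y) = (preAct y).comp (preAct x) := by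
    ext z
    simp [preAct, mul_assoc]
  exact DFunLike.congr_fun h a

theorem preAct_one (a : FreeGroup (R × FreeGroup X)) : preAct 1 a = a := by
  have h : preAct (R := R) (1 : FreeGroup X) = MonoidHom.id _ := by
    ext z
    simp [preAct]
  exact DFunLike.congr_fun h a

theorem peiffer_subset_ker : P.peiffer ⊆ P.preδ₂.ker := by
  rintro _ ⟨a, b, rfl⟩
  simp [MonoidHom.mem_ker, preδ₂_preAct, mul_assoc]

/-- The boundary `δ₂ : C(R) → F(X)`, `(r, u) ↦ u⁻¹ (w r) u`. -/
def δ₂ : P.C →* FreeGroup X :=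
  QuotientGroup.lift _ P.preδ₂ (Subgroup.normalClosure_le_normal P.peiffer_subset_ker)

theorem preAct_peiffer (x : FreeGroup X) :
    Subgroup.normalClosure P.peiffer ≤ (Subgroup.normalClosure P.peiffer).comap (preAct x) := by
  refine Subgroup.normalClosure_le_normal ?_
  rintro _ ⟨a, b, rfl⟩
  refine Subgroup.subset_normalClosure ⟨preAct x a, preAct x b, ?_⟩
  simp only [map_mul, map_inv, preδ₂_preAct, ← preAct_mul]
  simp [mul_assoc]

/-- The operation `c ↦ c ^ x` of `x ∈ F(X)` on `C(R)`. -/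
def act (x : FreeGroup X) : P.C →* P.C :=
  QuotientGroup.map _ _ (preAct x) (P.preAct_peiffer x)

/-- The right action of `F(X)` on `C(R)`: `c <• x` is `c ^ x`. -/
instance : MulDistribMulAction (FreeGroup X)ᵐᵒᵖ P.C where
  smul x c := P.act x.unop c
  one_smul c := by
    obtain ⟨a, rfl⟩ := P.mkC_surjective c
    exact congrArg P.mkC (preAct_one a)
  mul_smul x y c := by
    obtain ⟨a, rfl⟩ := P.mkC_surjective c
    exact congrArg P.mkC (preAct_mul y.unop x.unop a)
  smul_mul x c d := map_mul (P.act x.unop) c d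
  smul_one x := map_one (P.act x.unop)

/-- The first axiom of crossed modules. -/
theorem δ₂_act (c : P.C) (x : FreeGroup X) : P.δ₂ (c <• x) = x⁻¹ * P.δ₂ c * x := by
  obtain ⟨a, rfl⟩ := P.mkC_surjective c
  exact P.preδ₂_preAct x a

/-- The second axiom of crossed modules (the Peiffer relation). -/
theorem act_δ₂ (c d : P.C) : d <• P.δ₂ c = c⁻¹ * d * c := by
  obtain ⟨a, rfl⟩ := P.mkC_surjective c
  obtain ⟨b, rfl⟩ := P.mkC_surjective d
  have h : P.mkC (a⁻¹ * b * a * (preAct (P.preδ₂ a) b)⁻¹) = 1 :=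
    (QuotientGroup.eq_one_iff _).2 (Subgroup.subset_normalClosure ⟨a, b, rfl⟩)
  rw [map_mul, map_inv, mul_inv_eq_one] at h
  exact h.symm.trans (by simp)

@[simp]
theorem δ₂_ι (r : R) : P.δ₂ (P.ι r) = P.rel r := by
  change P.preδ₂ (FreeGroup.of (r, 1)) = P.rel r
  simp [preδ₂]

/-! ### The module of identities among relations -/

/-- The group `π₂(P) = ker δ₂` of identities among relations. -/
def π₂ : Subgroup P.C := P.δ₂.ker

theorem mul_comm_of_mem_π₂ {c : P.C} (hc : c ∈ P.π₂) (d : P.C) : c * d = d * c := by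
  have h := P.act_δ₂ c d
  rw [show P.δ₂ c = 1 from hc, MulOpposite.op_one, one_smul] at h
  calc c * d = c * (c⁻¹ * d * c) := by rw [← h]
    _ = d * c := by simp [mul_assoc]

instance : CommGroup P.π₂ :=
  { (inferInstance : Group P.π₂) with
    mul_comm := fun c d => Subtype.ext (P.mul_comm_of_mem_π₂ c.2 d) }

theorem act_mem_π₂ {c : P.C} (hc : c ∈ P.π₂) (x : FreeGroup X) : c <• x ∈ P.π₂ := by
  have hc' : P.δ₂ c = 1 := hc
  change P.δ₂ (c <• x) = 1
  rw [δ₂_act, hc']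
  simp

/-- The right operation of `F(X)` on `π₂(P)`, written additively, as a homomorphism. -/
def actHom : FreeGroup X →* (AddMonoid.End (Additive P.π₂))ᵐᵒᵖ where
  toFun x := MulOpposite.op
    { toFun := fun c => Additive.ofMul ⟨c.toMul.1 <• x, P.act_mem_π₂ c.toMul.2 x⟩
      map_zero' := congrArg Additive.ofMul (Subtype.ext (smul_one (MulOpposite.op x)))
      map_add' := fun c d => congrArg Additive.ofMul (Subtype.ext (smul_mul' (MulOpposite.op x) _ _)) }
  map_one' := by
    refine congrArg MulOpposite.op (AddMonoidHom.ext fun c => ?_)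
    exact congrArg Additive.ofMul (Subtype.ext (one_smul _ _))
  map_mul' x y := by
    refine congrArg MulOpposite.op (AddMonoidHom.ext fun c => ?_)
    exact congrArg Additive.ofMul (Subtype.ext (mul_smul (MulOpposite.op y) (MulOpposite.op x) _))

theorem ker_θ_le_ker_actHom : P.θ.ker ≤ P.actHom.ker := by
  rw [θ, P.ker_lift_gen]
  refine Subgroup.normalClosure_le_normal ?_
  rintro _ ⟨r, rfl⟩
  refine congrArg MulOpposite.op (AddMonoidHom.ext fun c => ?_)
  refine congrArg Additive.ofMul (Subtype.ext ?_)
  change c.toMul.1 <• P.rel r = c.toMul.1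
  rw [← δ₂_ι, act_δ₂, mul_assoc, P.mul_comm_of_mem_π₂ c.toMul.2, inv_mul_cancel_left]

theorem act_eq_of_θ_eq {u v : FreeGroup X} (huv : P.θ u = P.θ v) : P.actHom u = P.actHom v := by
  have h : P.actHom (u * v⁻¹) = 1 :=
    P.ker_θ_le_ker_actHom (by rw [MonoidHom.mem_ker, map_mul, huv, ← map_mul]; simp)
  calc P.actHom u = P.actHom (u * v⁻¹ * v) := by rw [inv_mul_cancel_right]
    _ = P.actHom v := by rw [map_mul, h, one_mul]

/-- The right operation of `G` on `π₂(P)` induced by that of `F(X)`: the element `θ u` operates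
as `u` does. -/
noncomputable def actHomG : G →* (AddMonoid.End (Additive P.π₂))ᵐᵒᵖ where
  toFun g := P.actHom (Function.surjInv P.θ_surjective g)
  map_one' := by
    rw [← map_one P.actHom]
    exact P.act_eq_of_θ_eq (by rw [Function.surjInv_eq P.θ_surjective, map_one])
  map_mul' g g' := by
    rw [← map_mul P.actHom]
    exact P.act_eq_of_θ_eq (by simp only [map_mul, Function.surjInv_eq P.θ_surjective])

/-- The right `ℤG`-module structure of `π₂(P)`, as a module over the opposite ring. -/
noncomputable instance : Module (MonoidAlgebra ℤ G)ᵐᵒᵖ (Additive P.π₂) :=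
  Module.compHom _
    ((RingEquiv.opOp (AddMonoid.End (Additive P.π₂))).symm.toRingHom.comp
      (RingHom.op (MonoidAlgebra.lift ℤ (AddMonoid.End (Additive P.π₂))ᵐᵒᵖ G
        P.actHomG).toRingHom))

/-- The group element `θ u` acts on `π₂(P)` by `c ↦ c ^ u`. -/
theorem of_θ_smul (c : P.π₂) (u : FreeGroup X) :
    Additive.ofMul c <• MonoidAlgebra.of ℤ G (P.θ u) =
      Additive.ofMul ⟨c.1 <• u, P.act_mem_π₂ c.2 u⟩ := by
  have h : MonoidAlgebra.lift ℤ (AddMonoid.End (Additive P.π₂))ᵐᵒᵖ G P.actHomG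
      (MonoidAlgebra.of ℤ G (P.θ u)) = P.actHom u := by
    rw [MonoidAlgebra.of_apply, MonoidAlgebra.lift_single, one_smul]
    exact P.act_eq_of_θ_eq (Function.surjInv_eq _ _)
  exact DFunLike.congr_fun (congrArg MulOpposite.unop h) (Additive.ofMul c)

/-! ### The covering crossed module over the Cayley graph -/

/-- The objects of the groupoid `F(X̃)`: the vertices of the Cayley graph. -/
@[ext]
structure Vertex (P : GroupPresentation G X R) where
  /-- the element of `G` that is the vertex -/
  elt : G

/-- The arrows `[g, u] : g ⟶ g (θ u)` of `F(X̃)`, for `u ∈ F(X)`. -/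
@[ext]
structure Path (a b : P.Vertex) where
  /-- the element `u` of `F(X)` -/
  word : FreeGroup X
  target : a.elt * P.θ word = b.elt

/-- The free groupoid `F(X̃)` on the Cayley graph, with `[g, u] ≫ [g (θ u), v] = [g, u v]`. -/
instance : Groupoid P.Vertex where
  Hom a b := P.Path a b
  id a := ⟨1, by simp⟩
  comp p q := ⟨p.word * q.word, by rw [map_mul, ← mul_assoc, p.target, q.target]⟩
  inv p := ⟨p.word⁻¹, by rw [map_inv, ← p.target, mul_inv_cancel_right]⟩
  id_comp p := Path.ext (one_mul _)
  comp_id p := Path.ext (mul_one _)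
  assoc p q s := Path.ext (mul_assoc _ _ _)
  inv_comp p := Path.ext (inv_mul_cancel _)
  comp_inv p := Path.ext (mul_inv_cancel _)

variable {P}

/-- The covering morphism `p₁ : F(X̃) → F(X)`, `[g, u] ↦ u`. -/
def p₁ {a b : P.Vertex} (p : a ⟶ b) : FreeGroup X := Path.word p

theorem hom_ext {a b : P.Vertex} {p q : a ⟶ b} (h : p₁ p = p₁ q) : p = q := Path.ext h

variable (P)

/-- The group `C(R̃)(g)` of the covering crossed module at the vertex `g`: the elements are the
pairs `[g, c]` with `c ∈ C(R)`, multiplied as in `C(R)`. -/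
@[ext]
structure CTilde (a : P.Vertex) where
  /-- the covering morphism `p₂ : C(R̃) → C(R)`, `[g, c] ↦ c` -/
  p₂ : P.C

namespace CTilde

variable {P} {a b : P.Vertex}

instance : Mul (P.CTilde a) := ⟨fun c d => ⟨c.p₂ * d.p₂⟩⟩
instance : One (P.CTilde a) := ⟨⟨1⟩⟩
instance : Inv (P.CTilde a) := ⟨fun c => ⟨c.p₂⁻¹⟩⟩

instance : Group (P.CTilde a) where
  mul_assoc c d e := CTilde.ext (mul_assoc _ _ _)
  one_mul c := CTilde.ext (one_mul _)
  mul_one c := CTilde.ext (mul_one _)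
  inv_mul_cancel c := CTilde.ext (inv_mul_cancel _)

/-- The operation `[g, c] ^ [g, u] = [g (θ u), c ^ u]` of `F(X̃)` on `C(R̃)`. -/
def act (c : P.CTilde a) (p : a ⟶ b) : P.CTilde b := ⟨c.p₂ <• p₁ p⟩

end CTilde

theorem θ_δ₂ (c : P.C) : P.θ (P.δ₂ c) = 1 := by
  obtain ⟨a, rfl⟩ := P.mkC_surjective c
  have h : P.θ.comp P.preδ₂ = 1 := by
    ext y
    have hr : P.θ (P.rel y.1) = 1 := by
      have : P.rel y.1 ∈ P.θ.ker := by
        rw [θ, P.ker_lift_gen]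
        exact Subgroup.subset_normalClosure ⟨y.1, rfl⟩
      exact this
    simp [preδ₂, hr]
  exact DFunLike.congr_fun h a

/-- The boundary `δ̃₂ : C(R̃)(g) → F(X̃)(g, g)`, `[g, c] ↦ [g, δ₂ c]`; the multiplication of the
vertex group is composition of arrows from left to right. -/
def δ₂Tilde (a : P.Vertex) : P.CTilde a →* (a ⟶ a) where
  toFun c := (⟨P.δ₂ c.p₂, by rw [θ_δ₂, mul_one]⟩ : P.Path a a)
  map_one' := Path.ext (map_one P.δ₂)
  map_mul' c d := Path.ext (map_mul P.δ₂ c.p₂ d.p₂)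

/-- A partial contracting homotopy `h₀ : G → F(X̃)`, `h₁ : F(X̃) → C(R̃)` of the covering crossed
module. -/
structure ContractingHomotopy where
  /-- `h₀ g` is an arrow from `g` to `1` -/
  h₀ (a : P.Vertex) : a ⟶ ⟨1⟩
  h₀_one : h₀ ⟨1⟩ = 𝟙 (⟨1⟩ : P.Vertex)
  /-- `h₁` takes values in the group `C(R̃)(1)` -/
  h₁ {a b : P.Vertex} (p : a ⟶ b) : P.CTilde ⟨1⟩
  /-- `h₁` is a morphism from a groupoid to a group -/
  h₁_comp {a b c : P.Vertex} (p : a ⟶ b) (q : b ⟶ c) : h₁ (p ≫ q) = h₁ p * h₁ q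
  /-- `δ̃₂ h₁ [g, u] = (h₀ g)⁻¹ [g, u] h₀ (g (θ u))` -/
  δ₂Tilde_h₁ {a b : P.Vertex} (p : a ⟶ b) :
    P.δ₂Tilde ⟨1⟩ (h₁ p) = Groupoid.inv (h₀ a) ≫ p ≫ h₀ b

namespace ContractingHomotopy

variable {P} (h : P.ContractingHomotopy)

/-- The section `σ : G → F(X)` of `θ` that corresponds to `h₀`: `h₀ g = [g, (σ g)⁻¹]`. -/
def σ (g : G) : FreeGroup X := (p₁ (h.h₀ ⟨g⟩))⁻¹

/-- The separation element `sep(g, r) = p₂(h₁ δ̃₂ [g, r])⁻¹ r ^ (σ g)⁻¹` of `C(R)`. -/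
def sep (g : G) (r : R) : P.C :=
  (h.h₁ (P.δ₂Tilde ⟨g⟩ ⟨P.ι r⟩)).p₂⁻¹ * (P.ι r <• (h.σ g)⁻¹)

end ContractingHomotopy

end GroupPresentation

namespace GroupPresentation

variable {G X R : Type*} [Group G] {P : GroupPresentation G X R}

/-! For fixed `g`, the maps `c ↦ p₂(h₁ δ̃₂ [g, c])` and `c ↦ c ^ (σ g)⁻¹` are endomorphisms of
`C(R)` with the same boundary `σ g * δ₂ c * (σ g)⁻¹`. They therefore differ by elements of `π₂`,
which are central, so their quotient is a homomorphism `sepHom g : C(R) → π₂` extending `sep(g, -)`.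

Two facts finish the proof. Acting by `u` only moves the vertex: `sepHom g (c ^ u) = sepHom (g
θ(u)⁻¹) c` (`sepHom_act`), so all values of `sepHom g` are products of separation elements and their
inverses. And `sepHom 1` is the identity on `π₂` (`sepHom_one_of_mem_π₂`), so every identity among
relations is such a product. -/

theorem mkC_of (r : R) (u : FreeGroup X) : P.mkC (FreeGroup.of (r, u)) = P.ι r <• u := by
  change _ = P.mkC (preAct u (FreeGroup.of (r, 1)))
  simp [preAct]

/-- `C(R)` is generated by the elements `r ^ u`. -/
theorem C_induction {p : P.C → Prop} (one : p 1) (of : ∀ r (u : FreeGroup X), p (P.ι r <• u))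
    (inv : ∀ c, p c → p c⁻¹) (mul : ∀ c d, p c → p d → p (c * d)) (c : P.C) : p c := by
  obtain ⟨a, rfl⟩ := P.mkC_surjective c
  induction a using FreeGroup.induction_on with
  | C1 => simpa using one
  | of y => exact (mkC_of (P := P) y.1 y.2) ▸ of y.1 y.2
  | inv_of y hy => simpa only [map_inv] using inv _ hy
  | mul a b ha hb => simpa only [map_mul] using mul _ _ ha hb

namespace ContractingHomotopy

variable (h : P.ContractingHomotopy)

theorem h₁_id (a : P.Vertex) : h.h₁ (𝟙 a) = 1 := by
  have := h.h₁_comp (𝟙 a) (𝟙 a)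
  rw [Category.comp_id] at this
  exact left_eq_mul.1 this

theorem h₁_inv {a b : P.Vertex} (p : a ⟶ b) : h.h₁ (Groupoid.inv p) = (h.h₁ p)⁻¹ := by
  rw [eq_inv_iff_mul_eq_one, ← h.h₁_comp, Groupoid.inv_comp, h₁_id]

theorem σ_one : h.σ 1 = 1 := by
  rw [σ, h.h₀_one]
  exact inv_one

/-- Condition (iii) on `h₁`, projected to `F(X)`; the inverses change sides because `h₀ a` carries
the word `(σ a)⁻¹`. -/
theorem δ₂_h₁ {a b : P.Vertex} (p : a ⟶ b) :
    P.δ₂ (h.h₁ p).p₂ = h.σ a.elt * p₁ p * (h.σ b.elt)⁻¹ := by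
  have := congrArg p₁ (h.δ₂Tilde_h₁ p)
  change P.δ₂ (h.h₁ p).p₂ = (p₁ (h.h₀ a))⁻¹ * (p₁ p * p₁ (h.h₀ b)) at this
  rw [this, σ, σ, inv_inv, mul_assoc]

/-- The homomorphism `c ↦ p₂(h₁ δ̃₂ [g, c])`. -/
def h₁Boundary (g : G) : P.C →* P.C where
  toFun c := (h.h₁ (P.δ₂Tilde ⟨g⟩ ⟨c⟩)).p₂
  map_one' := congrArg CTilde.p₂ ((congrArg h.h₁ (map_one (P.δ₂Tilde ⟨g⟩))).trans (h.h₁_id _))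
  map_mul' c d := congrArg CTilde.p₂
    ((congrArg h.h₁ (map_mul (P.δ₂Tilde ⟨g⟩) ⟨c⟩ ⟨d⟩)).trans (h.h₁_comp _ _))

theorem δ₂_h₁Boundary (g : G) (c : P.C) :
    P.δ₂ (h.h₁Boundary g c) = h.σ g * P.δ₂ c * (h.σ g)⁻¹ :=
  h.δ₂_h₁ _

theorem sepC_mem (g : G) (c : P.C) :
    (h.h₁Boundary g c)⁻¹ * (c <• (h.σ g)⁻¹) ∈ P.π₂ := by
  rw [π₂, MonoidHom.mem_ker, map_mul, map_inv, δ₂_h₁Boundary, δ₂_act]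
  group

/-- The extension `c ↦ p₂(h₁ δ̃₂ [g, c])⁻¹ c ^ (σ g)⁻¹` of `sep(g, -)` to `C(R)`. It is a
homomorphism because its values are central. -/
def sepHom (g : G) : P.C →* P.π₂ where
  toFun c := ⟨_, h.sepC_mem g c⟩
  map_one' := Subtype.ext (by simp)
  map_mul' c d := Subtype.ext (by
    -- The value at `c` is central, so it can be moved past the inverted `h₁` factor of `d`.
    have hc := P.mul_comm_of_mem_π₂ (h.sepC_mem g c) (h.h₁Boundary g d)⁻¹
    simp only [map_mul, smul_mul', mul_inv_rev, Subgroup.coe_mul]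
    simp only [← mul_assoc] at hc ⊢
    rw [hc])

theorem coe_sepHom (g : G) (c : P.C) :
    (h.sepHom g c : P.C) = (h.h₁Boundary g c)⁻¹ * (c <• (h.σ g)⁻¹) := rfl

theorem coe_sepHom_ι (g : G) (r : R) : (h.sepHom g (P.ι r) : P.C) = h.sep g r := rfl

/-- Boundaries act by conjugation, and `π₂` is central. -/
theorem act_δ₂_of_mem_π₂ {c : P.C} (hc : c ∈ P.π₂) (d : P.C) : c <• P.δ₂ d = c := by
  rw [act_δ₂, mul_assoc, P.mul_comm_of_mem_π₂ hc, inv_mul_cancel_left]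

/-- The conjugation formula for `h₁` along the arrow `[g (θ u)⁻¹, u]`. -/
theorem h₁Boundary_act (g : G) (c : P.C) (u : FreeGroup X)
    (p : (⟨g * (P.θ u)⁻¹⟩ : P.Vertex) ⟶ ⟨g⟩) (hp : p₁ p = u) :
    h.h₁Boundary g (c <• u) = h.h₁Boundary (g * (P.θ u)⁻¹) c <• P.δ₂ (h.h₁ p).p₂ := by
  -- Equivariance of `δ̃₂` along `p`. Applying `h₁` yields conjugation by `h₁ p`, which the Peiffer
  -- relation turns into the action of its boundary.
  have e : P.δ₂Tilde ⟨g⟩ ⟨c <• u⟩ =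
      Groupoid.inv p ≫ P.δ₂Tilde ⟨g * (P.θ u)⁻¹⟩ ⟨c⟩ ≫ p := by
    refine hom_ext ?_
    change P.δ₂ (c <• u) = (p₁ p)⁻¹ * (P.δ₂ c * p₁ p)
    rw [δ₂_act, hp, mul_assoc]
  change (h.h₁ (P.δ₂Tilde ⟨g⟩ ⟨c <• u⟩)).p₂ = _
  rw [e, h.h₁_comp, h.h₁_comp, h.h₁_inv, act_δ₂, mul_assoc]
  rfl

/-- Moving along `p = [g θ(u)⁻¹, u]` changes both factors by the action of the boundary of `h₁ p`,
and that action is trivial on `π₂`. -/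
theorem sepHom_act (g : G) (c : P.C) (u : FreeGroup X) :
    h.sepHom g (c <• u) = h.sepHom (g * (P.θ u)⁻¹) c := by
  let p : (⟨g * (P.θ u)⁻¹⟩ : P.Vertex) ⟶ ⟨g⟩ :=
    (⟨u, inv_mul_cancel_right _ _⟩ : P.Path ⟨g * (P.θ u)⁻¹⟩ ⟨g⟩)
  refine Subtype.ext ?_
  rw [← act_δ₂_of_mem_π₂ (h.sepHom (g * (P.θ u)⁻¹) c).2 (h.h₁ p).p₂, coe_sepHom, coe_sepHom,
    h.h₁Boundary_act g c u p rfl, smul_mul', smul_inv']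
  congr 1
  have hp : p₁ p = u := rfl
  -- The boundary of `h₁ p` is `σ(g θ(u)⁻¹) u (σ g)⁻¹`; its first factor cancels the exponent `σ(g
  -- θ(u)⁻¹)⁻¹`.
  rw [δ₂_h₁, hp, ← mul_smul, ← mul_smul, ← MulOpposite.op_mul, ← MulOpposite.op_mul,
    mul_assoc, inv_mul_cancel_left]

/-- At the vertex `1` the `h₁` factor is trivial, because `δ̃₂ [1, c]` is an identity arrow, and the
exponent is trivial by the normalisation `σ 1 = 1`. -/
theorem sepHom_one_of_mem_π₂ {c : P.C} (hc : c ∈ P.π₂) : (h.sepHom 1 c : P.C) = c := by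
  have e : P.δ₂Tilde ⟨1⟩ ⟨c⟩ = 𝟙 (⟨1⟩ : P.Vertex) := hom_ext hc
  have e' : h.h₁Boundary 1 c = 1 := by
    change (h.h₁ (P.δ₂Tilde ⟨1⟩ ⟨c⟩)).p₂ = 1
    rw [e, h₁_id]
    rfl
  rw [coe_sepHom, e', σ_one]
  simp

theorem sepHom_mem_closure (c : P.C) : ∀ g,
    h.sepHom g c ∈ Subgroup.closure (Set.range fun x : G × R => h.sepHom x.1 (P.ι x.2)) := by
  induction c using C_induction with
  | one => exact fun g => (map_one (h.sepHom g)).symm ▸ one_mem _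
  | of r u =>
    intro g
    rw [sepHom_act]
    exact Subgroup.subset_closure ⟨(g * (P.θ u)⁻¹, r), rfl⟩
  | inv c hc => exact fun g => (map_inv (h.sepHom g) c).symm ▸ inv_mem (hc g)
  | mul c d hc hd => exact fun g => (map_mul (h.sepHom g) c d).symm ▸ mul_mem (hc g) (hd g)

/-- The separation elements generate `π₂(P)` already as a group. -/
theorem closure_sepHom_ι :
    Subgroup.closure (Set.range fun x : G × R => h.sepHom x.1 (P.ι x.2)) = ⊤ := by
  refine eq_top_iff.2 fun c _ => ?_
  rw [← show h.sepHom 1 c.1 = c from Subtype.ext (h.sepHom_one_of_mem_π₂ c.2)]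
  exact h.sepHom_mem_closure _ _

end ContractingHomotopy

end GroupPresentation

theorem proposition5p3p1 {G X R : Type*} [Group G] (P : GroupPresentation G X R)
    (h : P.ContractingHomotopy) :
    (∀ (g : G) (r : R), h.sep g r ∈ P.π₂) ∧
      Submodule.span (MonoidAlgebra ℤ G)ᵐᵒᵖ
        {c : Additive P.π₂ | ∃ (g : G) (r : R), (c.toMul : P.C) = h.sep g r} = ⊤ := by
  refine ⟨fun g r => h.sepC_mem g (P.ι r), eq_top_iff.2 fun c _ => ?_⟩
  have hc : c.toMul ∈ Subgroup.closure
      (Set.range fun x : G × R => h.sepHom x.1 (P.ι x.2)) := by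
    rw [h.closure_sepHom_ι]
    trivial
  -- Generation as a group suffices: the closure induction needs only the additive structure of the
  -- span, not the action of `G`.
  change Additive.ofMul c.toMul ∈ _
  generalize c.toMul = d at hc ⊢
  induction hc using Subgroup.closure_induction with
  | mem x hx =>
    obtain ⟨⟨g, r⟩, rfl⟩ := hx
    exact Submodule.subset_span ⟨g, r, h.coe_sepHom_ι g r⟩
  | one => exact zero_mem _
  | mul x y _ _ hx hy => exact add_mem hx hy
  | inv x _ hx => exact neg_mem hx
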